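/- For $r,s,n\in\mathbb N$ with $1\le s\le n$ and $r\ge 1$, let $\Sigma_{s,r}$ be the set of all $Z\in\mathbb R^{n\times n}$ with $\operatorname{rank}(Z)\le r$ for which there are index sets $S,T\subseteq\{1,\dots,n\}$ with $|S|=|T|=s$ such that $Z_{k,l}=0$ whenever $k\notin S$ or $l\notin T$. A Gaussian random map is a map $\mathcal A:\mathbb R^{n\times n}\to\mathbb R^m$, $\mathcal A(Z)=(\langle A_i,Z\rangle_F)_{i=1}^m$, where $\langle A,Z\rangle_F=\operatorname{tr}(A^\top Z)$ and the $n\times n$ random matrices $A_1,\dots,A_m$ are independent, each with independent $\mathcal N(0,1)$ entries. **Theorem.** There are absolute constants $C,c>0$ such that the following holds for all $n,m,r,s$ as above, every Gaussian random map $\mathcal A:\mathbb R^{n\times n}\to\mathbb R^m$ and every $\delta\in(0,1)$. If $$\text{(a)}\quad s\le \frac n2\ \text{ and }\ m\ge \frac{C}{\delta^{2}}\,rs\ln\Big(\frac ns\Big),\qquad\text{or}\qquad\text{(b)}\quad m\ge \frac{C}{\delta^{2}}\,rs\ln\Big(\frac{en}{s}\Big),$$ then, with probability at least $1-2\exp(-c\,\delta^2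 m)$, one has for all $Z\in\Sigma_{s,r}$ simultaneously $$(1-\delta)\,\|Z\|_F\ \le\ \frac{\sqrt{\pi/2}}{m}\,\|\mathcal A(Z)\|_1\ \le\ (1+\delta)\,\|Z\|_F .$$ -/

import Mathlib

open MeasureTheory ProbabilityTheory

open scoped Matrix Matrix.Norms.Frobenius

/-- The set `Σ_{s,r}` of real `n × n` matrices that have rank at most `r` and are supported on
`S × T` for some index sets `S`, `T` of size `s`. -/
def bisparseLowRank (n s r : ℕ) : Set (Matrix (Fin n) (Fin n) ℝ) :=
  {X | X.rank ≤ r ∧ ∃ S T : Finset (Fin n), S.card = s ∧ T.card = s ∧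
    (∀ i, i ∉ S → ∀ j, X i j = 0) ∧ (∀ i j, j ∉ T → X i j = 0)}

/-- The linear map `M ↦ (⟨A i, M⟩_F)_i`, where `⟨A, M⟩_F = tr (Aᵀ M)` is the Frobenius inner
product. -/
def sensingMap {n m : ℕ} (A : Fin m → Matrix (Fin n) (Fin n) ℝ) :
    Matrix (Fin n) (Fin n) ℝ →ₗ[ℝ] (Fin m → ℝ) where
  toFun M := fun i => ((A i)ᵀ * M).trace
  map_add' M N := by
    funext i
    simp [Matrix.mul_add]
  map_smul' a M := by
    funext i
    simp

/-- The random matrices `A 0, …, A (m - 1)` are independent standard Gaussian matrices: all their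
entries together form an independent family of `N(0,1)` random variables. -/
structure IsGaussianSensing {Ω : Type*} [MeasurableSpace Ω] (μ : Measure Ω) {n m : ℕ}
    (A : Fin m → Ω → Matrix (Fin n) (Fin n) ℝ) : Prop where
  hasLaw : ∀ i k l, HasLaw (fun ω => A i ω k l) (gaussianReal 0 1) μ
  indep : iIndepFun (fun (q : Fin m × Fin n × Fin n) (ω : Ω) => A q.1 ω q.2.1 q.2.2) μ

/-- The restricted isometry property on `Σ_{s,r}`, from the Frobenius norm to the `ℓ¹` norm scaled
by `√(π/2) / m`. The norm of `Z` is the Frobenius norm. -/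
def SatisfiesRIP {n m : ℕ} (𝒜 : Matrix (Fin n) (Fin n) ℝ →ₗ[ℝ] (Fin m → ℝ)) (s r : ℕ) (δ : ℝ) :
    Prop :=
  ∀ Z ∈ bisparseLowRank n s r,
    (1 - δ) * ‖Z‖ ≤ √(Real.pi / 2) / m * ‖WithLp.toLp 1 (𝒜 Z)‖ ∧
      √(Real.pi / 2) / m * ‖WithLp.toLp 1 (𝒜 Z)‖ ≤ (1 + δ) * ‖Z‖

/-! By homogeneity it suffices to control, uniformly over the unit-norm Z in Σ, the deviation of ∑ᵢ
|⟨Aᵢ, Z⟩| from its mean m√(2/π). The exponential moment of the supremum is bounded by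
symmetrization: subtract an independent copy, exchange rows of the two copies according to a sign
pattern, and decouple them by 2ab ≤ a² + b². Averaging over signs, Rademacher contraction
(`sum_signs_iSup_abs_le`) removes the absolute values, and the symmetry of the Gaussian law then
removes the signs. What is left is the supremum of the linear functional Z ↦ ⟨∑ᵢ Aᵢ, Z⟩
(`sum_signedMoment_le`). Hence a finite set norming linear functionals up to a constant is enough,
and no increments of the ℓ¹ process have to be estimated.

For fixed supports, a matrix in the unit ball of Σ is a product UW with U of size s × r and operator
norm at most 1, and W of size r × s and Frobenius norm at most 1. Since ⟨h, UW⟩ is linear in each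
factor, volumetric norming sets of size 5^(sr) for the two unit balls suffice, each costing a factor
2 (`exists_norming_blockProduct`). Counting supports gives at most binom(n,s)² · 5^(2sr) ≤ exp(6rs
ln(en/s)) points, and the hypothesis on m makes this exponent at most half of the Chernoff exponent.
-/

/-! ### Gaussian linear forms, their exponential moments and the first absolute moment. -/

/-- The law of a family of independent standard Gaussian variables indexed by `Q`. -/
noncomputable abbrev stdGaussianPi (Q : Type*) [Fintype Q] : Measure (Q → ℝ) :=
  Measure.pi fun _ => gaussianReal 0 1

theorem stdGaussianPi_map_sum_mul {Q : Type*} [Fintype Q] (w : Q → ℝ) :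
    (stdGaussianPi Q).map (fun x => ∑ q, x q * w q) = gaussianReal 0 (∑ q, w q ^ 2).toNNReal := by
  have hm : Measurable fun x : Q → ℝ => ∑ q, x q * w q := by fun_prop
  have := Measure.isProbabilityMeasure_map (μ := stdGaussianPi Q) hm.aemeasurable
  refine Measure.ext_of_charFun (funext fun t => ?_)
  rw [charFun_apply_real, integral_map hm.aemeasurable (by fun_prop)]
  have h1 : ∀ x : Q → ℝ, Complex.exp (t * ((∑ q, x q * w q : ℝ) : ℂ) * Complex.I) =
      ∏ q, Complex.exp (((t * w q : ℝ) : ℂ) * (x q : ℂ) * Complex.I) := by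
    intro x
    rw [← Complex.exp_sum]
    congr 1
    push_cast
    rw [Finset.mul_sum, Finset.sum_mul]
    exact Finset.sum_congr rfl fun q _ => by ring
  simp_rw [h1]
  rw [integral_fintype_prod_eq_prod (𝕜 := ℂ)
    (fun q (y : ℝ) => Complex.exp (((t * w q : ℝ) : ℂ) * (y : ℂ) * Complex.I))]
  simp_rw [← charFun_apply_real, charFun_gaussianReal]
  rw [← Complex.exp_sum]
  congr 1
  have hw : (((∑ q, w q ^ 2).toNNReal : NNReal) : ℝ) = ∑ q, w q ^ 2 :=
    Real.coe_toNNReal _ (Finset.sum_nonneg fun q _ => sq_nonneg _)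
  have hw' : ((((∑ q, w q ^ 2).toNNReal : NNReal) : ℝ) : ℂ) = ∑ q, (w q : ℂ) ^ 2 := by
    rw [hw]; push_cast; rfl
  simp only [Complex.ofReal_zero, mul_zero, zero_mul, zero_sub, NNReal.coe_one, Complex.ofReal_one,
    one_mul]
  rw [hw', Finset.sum_mul, Finset.sum_div, ← Finset.sum_neg_distrib]
  exact Finset.sum_congr rfl fun q _ => by push_cast; ring

theorem lintegral_exp_gaussianReal_zero (v : NNReal) (t : ℝ) :
    ∫⁻ y, ENNReal.ofReal (Real.exp (t * y)) ∂gaussianReal 0 v =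
      ENNReal.ofReal (Real.exp (v * t ^ 2 / 2)) := by
  rw [← ofReal_integral_eq_lintegral_ofReal (integrable_exp_mul_gaussianReal t)
    (.of_forall fun _ => (Real.exp_pos _).le)]
  congr 1
  have := congrFun (mgf_id_gaussianReal (μ := 0) (v := v)) t
  simpa [mgf] using this

theorem integral_abs_gaussianReal : ∫ y, |y| ∂gaussianReal 0 1 = √(2 / Real.pi) := by
  rw [integral_gaussianReal_eq_integral_smul one_ne_zero]
  have h1 : ∀ x : ℝ, gaussianPDFReal 0 1 x • |x| =
      (√(2 * Real.pi))⁻¹ * (|x| ^ (1 : ℝ) * Real.exp (-(1 / 2) * |x| ^ (2 : ℝ))) := by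
    intro x
    simp [gaussianPDFReal]
    ring_nf
  simp_rw [h1]
  rw [integral_const_mul, integral_comp_abs
    (f := fun x => x ^ (1 : ℝ) * Real.exp (-(1 / 2) * x ^ (2 : ℝ))),
    integral_rpow_mul_exp_neg_mul_rpow (by norm_num) (by norm_num) (by norm_num)]
  norm_num
  have hp := Real.pi_pos
  have h2 : √2 * √2 = 2 := Real.mul_self_sqrt (by norm_num)
  field_simp
  nlinarith

theorem integrable_abs_gaussianReal : Integrable (fun y : ℝ => |y|) (gaussianReal 0 1) :=
  ((memLp_id_gaussianReal (μ := 0) (v := 1) 1).integrable le_rfl).abs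

/-! ### Rows of a Gaussian array and the symmetries of its law. -/

section rows

variable {ι d : Type*} [Fintype d]

/-- The inner product of the `i`-th row of `x` with `z`. -/
def rowInner (x : ι × d → ℝ) (i : ι) (z : d → ℝ) : ℝ := ∑ k, x (i, k) * z k

@[fun_prop]
theorem measurable_rowInner (i : ι) (z : d → ℝ) :
    Measurable fun x : ι × d → ℝ => rowInner x i z := by
  unfold rowInner; fun_prop

theorem rowInner_eq_sum [Fintype ι] [DecidableEq ι] (x : ι × d → ℝ) (i : ι) (z : d → ℝ) :
    rowInner x i z = ∑ q : ι × d, x q * (if q.1 = i then z q.2 else 0) := by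
  rw [Fintype.sum_prod_type, Finset.sum_eq_single i]
  · simp [rowInner]
  · intro b _ hb
    simp [hb]
  · simp

theorem map_rowInner [Fintype ι] (i : ι) (z : d → ℝ) (hz : ∑ k, z k ^ 2 = 1) :
    (stdGaussianPi (ι × d)).map (fun x => rowInner x i z) = gaussianReal 0 1 := by
  classical
  simp_rw [rowInner_eq_sum]
  rw [stdGaussianPi_map_sum_mul]
  congr 1
  rw [Fintype.sum_prod_type, Finset.sum_eq_single i]
  · simp [hz]
  · intro b _ hb
    simp [hb]
  · simp

theorem integrable_abs_rowInner [Fintype ι] (i : ι) (z : d → ℝ) (hz : ∑ k, z k ^ 2 = 1) :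
    Integrable (fun x => |rowInner x i z|) (stdGaussianPi (ι × d)) := by
  have h := integrable_abs_gaussianReal
  rw [← map_rowInner i z hz] at h
  exact h.comp_measurable (by fun_prop)

theorem integral_abs_rowInner [Fintype ι] (i : ι) (z : d → ℝ) (hz : ∑ k, z k ^ 2 = 1) :
    ∫ x, |rowInner x i z| ∂stdGaussianPi (ι × d) = √(2 / Real.pi) := by
  rw [← integral_abs_gaussianReal, ← map_rowInner i z hz, integral_map (by fun_prop) (by fun_prop)]

theorem lintegral_exp_sum_rowInner_le [Fintype ι] (z : d → ℝ) (hz : ∑ k, z k ^ 2 ≤ 1) (t : ℝ) :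
    ∫⁻ x, ENNReal.ofReal (Real.exp (t * ∑ i, rowInner x i z)) ∂stdGaussianPi (ι × d) ≤
      ENNReal.ofReal (Real.exp (Fintype.card ι * t ^ 2 / 2)) := by
  have h1 : ∀ x : ι × d → ℝ, ∑ i, rowInner x i z = ∑ q : ι × d, x q * z q.2 := by
    intro x
    rw [Fintype.sum_prod_type]
    rfl
  simp_rw [h1]
  have hm : Measurable fun x : ι × d → ℝ => ∑ q, x q * z q.2 := by fun_prop
  have h2 := lintegral_exp_gaussianReal_zero (∑ q : ι × d, z q.2 ^ 2).toNNReal t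
  rw [← stdGaussianPi_map_sum_mul, lintegral_map (by fun_prop) hm] at h2
  rw [h2, Real.coe_toNNReal _ (Finset.sum_nonneg fun q _ => sq_nonneg _), Fintype.sum_prod_type]
  refine ENNReal.ofReal_le_ofReal (Real.exp_le_exp.2 ?_)
  simp only [Finset.sum_const, Finset.card_univ, nsmul_eq_mul]
  have : (Fintype.card ι : ℝ) * ∑ k, z k ^ 2 ≤ Fintype.card ι * 1 := by gcongr
  nlinarith [sq_nonneg t]

/-- Swapping the coordinates outside `s` preserves the law of a pair of independent Gaussian
arrays. -/
theorem measurePreserving_swapCoords {Q : Type*} [Fintype Q] (s : Q → Prop) [DecidablePred s] :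
    MeasurePreserving
      (fun p : (Q → ℝ) × (Q → ℝ) =>
        ((fun q => if s q then p.1 q else p.2 q, fun q => if s q then p.2 q else p.1 q) :
          (Q → ℝ) × (Q → ℝ)))
      ((stdGaussianPi Q).prod (stdGaussianPi Q)) ((stdGaussianPi Q).prod (stdGaussianPi Q)) := by
  have e := measurePreserving_arrowProdEquivProdArrow ℝ ℝ Q (fun _ => gaussianReal 0 1)
    (fun _ => gaussianReal 0 1)
  have h : MeasurePreserving (fun (a : Q → ℝ × ℝ) q => (if s q then id else Prod.swap) (a q))
      (Measure.pi fun _ : Q => (gaussianReal 0 1).prod (gaussianReal 0 1))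
      (Measure.pi fun _ : Q => (gaussianReal 0 1).prod (gaussianReal 0 1)) := by
    refine measurePreserving_pi _ _ (f := fun q => if s q then id else Prod.swap) fun q => ?_
    split_ifs
    · exact MeasurePreserving.id _
    · exact Measure.measurePreserving_swap
  convert! (e.comp h).comp (e.symm _) using 1
  funext p
  refine Prod.ext (funext fun q => ?_) (funext fun q => ?_) <;>
    simp only [Function.comp, MeasurableEquiv.arrowProdEquivProdArrow,
      Equiv.arrowProdEquivProdArrow] <;>
    split_ifs with hq <;> simp [hq]

/-- Symmetry of the centered Gaussian; used to discard the Rademacher signs once the absolute values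
are gone. -/
theorem measurePreserving_signRows [Fintype ι] (ε : ι → ℤˣ) :
    MeasurePreserving (fun (x : ι × d → ℝ) q => ((ε q.1 : ℤ) : ℝ) * x q)
      (stdGaussianPi (ι × d)) (stdGaussianPi (ι × d)) := by
  refine measurePreserving_pi _ _ (f := fun (q : ι × d) y => ((ε q.1 : ℤ) : ℝ) * y) fun q => ?_
  rcases Int.units_eq_one_or (ε q.1) with h | h
  · simp only [h, Units.val_one, Int.cast_one, one_mul]
    exact MeasurePreserving.id _
  · refine ⟨by fun_prop, ?_⟩
    simp [h, gaussianReal_map_neg]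

end rows

/-! ### Rademacher contraction for the absolute value. -/

/-- Fix the indices k, l of the two suprema on the left. If b k ≥ 0, they serve on the right in the
same order; if b k ≤ 0, then a k + |b k| = a k - b k and the two suprema on the right exchange
roles. In both cases -|b l| ≤ ± b l handles the other term. -/
theorem Monotone.iSup_add_iSup_abs_le {κ : Type*} {Φ : ℝ → ENNReal} (hΦ : Monotone Φ)
    (a b : κ → ℝ) :
    (⨆ k, Φ (a k + |b k|)) + ⨆ k, Φ (a k - |b k|) ≤
      (⨆ k, Φ (a k + b k)) + ⨆ k, Φ (a k - b k) := by
  cases isEmpty_or_nonempty κ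
  · simp
  refine ENNReal.iSup_add_iSup_le fun k l => ?_
  rcases le_total 0 (b k) with h | h
  · refine add_le_add (le_iSup_of_le k ?_) (le_iSup_of_le l (hΦ ?_))
    · rw [abs_of_nonneg h]
    · linarith [le_abs_self (b l)]
  · rw [add_comm (⨆ k, Φ (a k + b k))]
    refine add_le_add (le_iSup_of_le k ?_) (le_iSup_of_le l (hΦ ?_))
    · rw [abs_of_nonpos h, sub_eq_add_neg]
    · linarith [neg_abs_le (b l)]

section contraction

variable {ι κ : Type*} [Fintype ι] [DecidableEq ι]

/-- Contraction in one coordinate: pairing each sign pattern with its flip at j reduces the claim to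
the two-term inequality `Monotone.iSup_add_iSup_abs_le`. -/
theorem sum_signs_iSup_update_abs_le {Φ : ℝ → ENNReal} (hΦ : Monotone Φ) (t u : κ → ι → ℝ) (j : ι)
    (hj : ∀ k, u k j = |t k j|) (hne : ∀ k i, i ≠ j → u k i = t k i) :
    ∑ ε : ι → ℤˣ, ⨆ k, Φ (∑ i, ((ε i : ℤ) : ℝ) * u k i) ≤
      ∑ ε : ι → ℤˣ, ⨆ k, Φ (∑ i, ((ε i : ℤ) : ℝ) * t k i) := by
  set f : (ι → ℤˣ) → ENNReal := fun ε => ⨆ k, Φ (∑ i, ((ε i : ℤ) : ℝ) * u k i)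
  set g : (ι → ℤˣ) → ENNReal := fun ε => ⨆ k, Φ (∑ i, ((ε i : ℤ) : ℝ) * t k i)
  set s : ι → ℤˣ := Pi.mulSingle j (-1)
  have hs : s * s = 1 := by
    ext i
    by_cases h : i = j <;> simp [s, h]
  have split : ∀ (v : κ → ι → ℝ) (ε : ι → ℤˣ) (k : κ), ∑ i, ((ε i : ℤ) : ℝ) * v k i =
      ∑ i ∈ Finset.univ.erase j, ((ε i : ℤ) : ℝ) * v k i + ((ε j : ℤ) : ℝ) * v k j :=
    fun v ε k => (Finset.sum_erase_add _ _ (Finset.mem_univ j)).symm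
  have key : ∀ ε : ι → ℤˣ, ε j = 1 → f ε + f (s * ε) ≤ g ε + g (s * ε) := by
    intro ε hε
    have h1 : ∀ (v : κ → ι → ℝ) (k : κ),
        ∑ i ∈ Finset.univ.erase j, (((s * ε) i : ℤ) : ℝ) * v k i =
          ∑ i ∈ Finset.univ.erase j, ((ε i : ℤ) : ℝ) * v k i := fun v k =>
      Finset.sum_congr rfl fun i hi => by simp [s, Finset.ne_of_mem_erase hi]
    have h2 : ∀ k, ∑ i ∈ Finset.univ.erase j, ((ε i : ℤ) : ℝ) * u k i =
        ∑ i ∈ Finset.univ.erase j, ((ε i : ℤ) : ℝ) * t k i := fun k =>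
      Finset.sum_congr rfl fun i hi => by rw [hne k i (Finset.ne_of_mem_erase hi)]
    have h3 : (s * ε) j = -1 := by simp [s, hε]
    simp only [f, g, split u, split t, h1, h2, h3, hε, hj]
    simpa [sub_eq_add_neg] using hΦ.iSup_add_iSup_abs_le
      (fun k => ∑ i ∈ Finset.univ.erase j, ((ε i : ℤ) : ℝ) * t k i) (fun k => t k j)
  have key' : ∀ ε : ι → ℤˣ, f ε + f (s * ε) ≤ g ε + g (s * ε) := by
    intro ε
    rcases Int.units_eq_one_or (ε j) with h | h
    · exact key ε h
    · have := key (s * ε) (by simp [s, h])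
      rwa [← mul_assoc, hs, one_mul, add_comm, add_comm (g _)] at this
  have hsum : ∀ F : (ι → ℤˣ) → ENNReal, ∑ ε, (F ε + F (s * ε)) = 2 * ∑ ε, F ε := by
    intro F
    rw [Finset.sum_add_distrib, two_mul]
    congr 1
    exact Equiv.sum_comp (Equiv.mulLeft s) F
  have := Finset.sum_le_sum fun (ε : ι → ℤˣ) (_ : ε ∈ Finset.univ) => key' ε
  rw [hsum, hsum] at this
  exact (ENNReal.mul_le_mul_iff_right (by simp) (by simp)).1 this

/-- A contraction principle for Rademacher averages: taking absolute values of the coordinates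
does not increase the average over signs of a monotone function of the supremum. -/
theorem sum_signs_iSup_abs_le {Φ : ℝ → ENNReal} (hΦ : Monotone Φ) (t : κ → ι → ℝ) :
    ∑ ε : ι → ℤˣ, ⨆ k, Φ (∑ i, ((ε i : ℤ) : ℝ) * |t k i|) ≤
      ∑ ε : ι → ℤˣ, ⨆ k, Φ (∑ i, ((ε i : ℤ) : ℝ) * t k i) := by
  have h : ∀ J : Finset ι,
      ∑ ε : ι → ℤˣ, ⨆ k, Φ (∑ i, ((ε i : ℤ) : ℝ) * if i ∈ J then |t k i| else t k i) ≤
        ∑ ε : ι → ℤˣ, ⨆ k, Φ (∑ i, ((ε i : ℤ) : ℝ) * t k i) := by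
    intro J
    induction J using Finset.induction_on with
    | empty => simp
    | insert j J hj ih =>
      refine le_trans (sum_signs_iSup_update_abs_le hΦ _ _ j ?_ ?_) ih
      · simp [hj]
      · intro k i hi
        simp [hi]
  simpa using h Finset.univ

end contraction

/-! ### Symmetrization and the exponential moment of the supremum. -/

theorem ofReal_integral_le_lintegral_ofReal {Ω : Type*} [MeasurableSpace Ω] {μ : Measure Ω}
    {f : Ω → ℝ} (hf : Integrable f μ) :
    ENNReal.ofReal (∫ x, f x ∂μ) ≤ ∫⁻ x, ENNReal.ofReal (f x) ∂μ := by
  have h : ∫ x, f x ∂μ ≤ ∫ x, max (f x) 0 ∂μ :=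
    integral_mono hf hf.pos_part fun x => le_max_left _ _
  refine (ENNReal.ofReal_le_ofReal h).trans ?_
  rw [ofReal_integral_eq_lintegral_ofReal hf.pos_part (.of_forall fun x => le_max_right _ _)]
  simp

/-- Jensen via the tangent line of exp at the mean, so that exp ∘ f need not be integrable. -/
theorem ofReal_exp_integral_le {Ω : Type*} [MeasurableSpace Ω] {μ : Measure Ω}
    [IsProbabilityMeasure μ] {f : Ω → ℝ} (hf : Integrable f μ) :
    ENNReal.ofReal (Real.exp (∫ x, f x ∂μ)) ≤ ∫⁻ x, ENNReal.ofReal (Real.exp (f x)) ∂μ := by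
  set c := ∫ x, f x ∂μ with hc
  have hi' : Integrable (fun x => f x - c) μ := hf.sub (integrable_const _)
  have hi : Integrable (fun x => Real.exp c * (1 + (f x - c))) μ :=
    ((integrable_const _).add hi').const_mul _
  have h1 : ∫ x, Real.exp c * (1 + (f x - c)) ∂μ = Real.exp c := by
    rw [integral_const_mul, integral_add (integrable_const _) hi',
      integral_sub hf (integrable_const _)]
    simp [← hc]
  rw [← h1]
  refine (ofReal_integral_le_lintegral_ofReal hi).trans (lintegral_mono fun x => ?_)
  refine ENNReal.ofReal_le_ofReal ?_
  have h2 : Real.exp (f x) = Real.exp c * Real.exp (f x - c) := by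
    rw [← Real.exp_add, add_sub_cancel]
  rw [h2, add_comm]
  exact mul_le_mul_of_nonneg_left (Real.add_one_le_exp _) (Real.exp_pos _).le

section process

variable {ι d κ Y : Type*} [Fintype ι] [Fintype d] [Countable κ] [Fintype Y]

/-- Decouples the two independent copies at the price of doubling the exponent. -/
theorem ofReal_exp_sub_le (p q : ℝ) :
    ENNReal.ofReal (Real.exp (p - q)) ≤
      2⁻¹ * (ENNReal.ofReal (Real.exp (2 * p)) + ENNReal.ofReal (Real.exp (-(2 * q)))) := by
  rw [← ENNReal.ofReal_add (Real.exp_pos _).le (Real.exp_pos _).le,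
    ← ENNReal.ofReal_ofNat 2, ← ENNReal.ofReal_inv_of_pos (by norm_num),
    ← ENNReal.ofReal_mul (by norm_num)]
  refine ENNReal.ofReal_le_ofReal ?_
  have h1 : Real.exp (2 * p) = Real.exp p ^ 2 := by rw [← Real.exp_nat_mul]; simp
  have h2 : Real.exp (-(2 * q)) = Real.exp (-q) ^ 2 := by rw [← Real.exp_nat_mul]; simp
  rw [sub_eq_add_neg, Real.exp_add, h1, h2]
  linarith [sq_nonneg (Real.exp p - Real.exp (-q))]

/-- The exponential moment of the supremum of a signed Rademacher-weighted process. -/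
noncomputable def signedMoment (z : κ → d → ℝ) (l : ℝ) (ε : ι → ℤˣ) : ENNReal :=
  ∫⁻ x, ⨆ k, ENNReal.ofReal (Real.exp (2 * l * ∑ i, ((ε i : ℤ) : ℝ) * |rowInner x i (z k)|))
    ∂stdGaussianPi (ι × d)

/-- Jensen's inequality: centering is dominated by subtracting an independent copy. -/
theorem lintegral_iSup_exp_centered_le (z : κ → d → ℝ) (hz : ∀ k, ∑ j, z k j ^ 2 = 1) (a : ℝ) :
    ∫⁻ x, ⨆ k, ENNReal.ofReal (Real.exp
        (a * (∑ i, |rowInner x i (z k)| - Fintype.card ι * √(2 / Real.pi))))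
      ∂stdGaussianPi (ι × d) ≤
    ∫⁻ p, ⨆ k, ENNReal.ofReal (Real.exp
        (a * ∑ i, (|rowInner p.1 i (z k)| - |rowInner p.2 i (z k)|)))
      ∂(stdGaussianPi (ι × d)).prod (stdGaussianPi (ι × d)) := by
  rw [lintegral_prod _ (by fun_prop)]
  refine lintegral_mono fun x => ?_
  -- For fixed x, Jensen is applied in the second copy for each k, and sup ∫ ≤ ∫ sup.
  refine le_trans (iSup_mono fun k => ?_) (iSup_lintegral_le _)
  have hi : ∀ i ∈ (Finset.univ : Finset ι),
      Integrable (fun y => |rowInner x i (z k)| - |rowInner y i (z k)|) (stdGaussianPi (ι × d)) :=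
    fun i _ => (integrable_const _).sub (integrable_abs_rowInner i (z k) (hz k))
  have h := ofReal_exp_integral_le ((integrable_finsetSum _ hi).const_mul a)
  rw [integral_const_mul, integral_finsetSum _ hi] at h
  simp_rw [integral_sub (integrable_const _) (integrable_abs_rowInner _ (z k) (hz k)),
    integral_abs_rowInner _ _ (hz k), Finset.sum_sub_distrib] at h
  simpa [Finset.sum_sub_distrib] using h

theorem lintegral_iSup_exp_sub_le (z : κ → d → ℝ) (l : ℝ) (η : ℤˣ) (ε : ι → ℤˣ) :
    ∫⁻ p, ⨆ k, ENNReal.ofReal (Real.exp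
        (((η : ℤ) : ℝ) * l * ∑ i, (|rowInner p.1 i (z k)| - |rowInner p.2 i (z k)|)))
      ∂(stdGaussianPi (ι × d)).prod (stdGaussianPi (ι × d)) ≤
    2⁻¹ * (signedMoment z l (fun i => η * ε i) + signedMoment z l (fun i => -η * ε i)) := by
  classical
  have hG : Measurable fun p : (ι × d → ℝ) × (ι × d → ℝ) => ⨆ k, ENNReal.ofReal (Real.exp
      (((η : ℤ) : ℝ) * l * ∑ i, (|rowInner p.1 i (z k)| - |rowInner p.2 i (z k)|))) := by
    fun_prop
  -- Exchanging the rows with ε i = -1 multiplies the i-th difference by ε i.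
  rw [← (measurePreserving_swapCoords (fun q : ι × d => ε q.1 = 1)).lintegral_comp hG]
  have hs : ∀ (x y : ι × d → ℝ) (i : ι) (k : κ),
      |rowInner (fun q => if ε q.1 = 1 then x q else y q) i (z k)| -
        |rowInner (fun q => if ε q.1 = 1 then y q else x q) i (z k)| =
      ((ε i : ℤ) : ℝ) * |rowInner x i (z k)| - ((ε i : ℤ) : ℝ) * |rowInner y i (z k)| := by
    intro x y i k
    rcases Int.units_eq_one_or (ε i) with h | h
    · simp [rowInner, h]
    · simp [rowInner, h]
      ring
  set W : (ι → ℤˣ) → (ι × d → ℝ) → ENNReal := fun e x => ⨆ k, ENNReal.ofReal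
    (Real.exp (2 * l * ∑ i, ((e i : ℤ) : ℝ) * |rowInner x i (z k)|)) with hW
  have hWm : ∀ e, Measurable (W e) := fun e => by simp only [hW]; fun_prop
  have hb : ∀ p : (ι × d → ℝ) × (ι × d → ℝ),
      (⨆ k, ENNReal.ofReal (Real.exp (((η : ℤ) : ℝ) * l * ∑ i,
        (|rowInner (fun q => if ε q.1 = 1 then p.1 q else p.2 q) i (z k)| -
          |rowInner (fun q => if ε q.1 = 1 then p.2 q else p.1 q) i (z k)|)))) ≤
      2⁻¹ * (W (fun i => η * ε i) p.1 + W (fun i => -η * ε i) p.2) := by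
    intro p
    refine iSup_le fun k => ?_
    simp only [hs]
    rw [Finset.sum_sub_distrib, mul_sub]
    refine (ofReal_exp_sub_le _ _).trans ?_
    gcongr
    · refine le_iSup_of_le k (le_of_eq ?_)
      congr 2
      simp only [Units.val_mul, Int.cast_mul, mul_assoc, ← Finset.mul_sum]
      ring
    · refine le_iSup_of_le k (le_of_eq ?_)
      congr 2
      simp only [Units.val_mul, Units.val_neg, Int.cast_neg, neg_mul, Int.cast_mul, mul_assoc,
        ← Finset.mul_sum, Finset.sum_neg_distrib]
      ring
  refine (lintegral_mono hb).trans (le_of_eq ?_)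
  rw [lintegral_const_mul _ (by fun_prop), lintegral_add_left (by fun_prop)]
  congr 2
  · exact measurePreserving_fst.lintegral_comp (hWm _)
  · exact measurePreserving_snd.lintegral_comp (hWm _)

/-- After contraction and row symmetry every ε contributes the same integral. The functional is then
linear in `z k`, so the supremum is at most a sum over the norming set with 2l replaced by 4 · 2l =
8l, and (8l)²/2 = 32l². -/
theorem sum_signedMoment_le (z : κ → d → ℝ) {l : ℝ} (hl : 0 ≤ l) (y : Y → d → ℝ)
    (hy : ∀ c, ∑ j, y c j ^ 2 ≤ 1)
    (hnet : ∀ (h : d → ℝ) k, ∃ c, ∑ j, h j * z k j ≤ 4 * ∑ j, h j * y c j) [DecidableEq ι] :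
    ∑ ε : ι → ℤˣ, signedMoment z l ε ≤
      Fintype.card (ι → ℤˣ) *
        (Fintype.card Y * ENNReal.ofReal (Real.exp (32 * l ^ 2 * Fintype.card ι))) := by
  unfold signedMoment
  rw [← lintegral_finsetSum _ fun ε _ => by fun_prop]
  have hc : ∀ x : ι × d → ℝ,
      ∑ ε : ι → ℤˣ, ⨆ k, ENNReal.ofReal (Real.exp
        (2 * l * ∑ i, ((ε i : ℤ) : ℝ) * |rowInner x i (z k)|)) ≤
      ∑ ε : ι → ℤˣ, ⨆ k, ENNReal.ofReal (Real.exp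
        (2 * l * ∑ i, ((ε i : ℤ) : ℝ) * rowInner x i (z k))) := fun x =>
    sum_signs_iSup_abs_le (Φ := fun s => ENNReal.ofReal (Real.exp (2 * l * s)))
      (fun s t hst => ENNReal.ofReal_le_ofReal (Real.exp_le_exp.2 (by gcongr))) _
  refine (lintegral_mono hc).trans ?_
  rw [lintegral_finsetSum _ fun ε _ => by fun_prop]
  rw [← nsmul_eq_mul, ← Finset.card_univ]
  refine Finset.sum_le_card_nsmul _ _ _ fun ε _ => ?_
  have h1 : ∀ (x : ι × d → ℝ) (i : ι) (v : d → ℝ),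
      ((ε i : ℤ) : ℝ) * rowInner x i v = rowInner (fun q => ((ε q.1 : ℤ) : ℝ) * x q) i v := by
    intro x i v
    simp only [rowInner, Finset.mul_sum, mul_assoc]
  simp only [h1]
  have hm : Measurable fun x : ι × d → ℝ => ⨆ k, ENNReal.ofReal (Real.exp
      (2 * l * ∑ i, rowInner x i (z k))) := by fun_prop
  rw [(measurePreserving_signRows ε).lintegral_comp hm]
  have h2 : ∀ x : ι × d → ℝ, (⨆ k, ENNReal.ofReal (Real.exp (2 * l * ∑ i, rowInner x i (z k)))) ≤
      ∑ c, ENNReal.ofReal (Real.exp (8 * l * ∑ i, rowInner x i (y c))) := by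
    intro x
    refine iSup_le fun k => ?_
    have h3 : ∀ v : d → ℝ, ∑ i, rowInner x i v = ∑ j, (∑ i, x (i, j)) * v j := by
      intro v
      simp only [rowInner, Finset.sum_mul]
      exact Finset.sum_comm
    obtain ⟨c, hc⟩ := hnet (fun j => ∑ i, x (i, j)) k
    refine le_trans (ENNReal.ofReal_le_ofReal (Real.exp_le_exp.2 ?_))
      (Finset.single_le_sum (f := fun c => ENNReal.ofReal
        (Real.exp (8 * l * ∑ i, rowInner x i (y c)))) (fun _ _ => zero_le) (Finset.mem_univ c))
    rw [h3, h3]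
    nlinarith
  refine (lintegral_mono h2).trans ?_
  rw [lintegral_finsetSum _ fun c _ => by fun_prop, ← nsmul_eq_mul, ← Finset.card_univ]
  refine Finset.sum_le_card_nsmul _ _ _ fun c _ => ?_
  refine (lintegral_exp_sum_rowInner_le (y c) (hy c) (8 * l)).trans (le_of_eq ?_)
  congr 2
  ring

/-- Average the bound of `lintegral_iSup_exp_sub_le` over ε: both ηε and -ηε run through all sign
patterns, so either tail direction η gets the same bound. -/
theorem lintegral_iSup_exp_centered_le_card_mul (z : κ → d → ℝ) (hz : ∀ k, ∑ j, z k j ^ 2 = 1)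
    {l : ℝ} (hl : 0 ≤ l) (η : ℤˣ) (y : Y → d → ℝ) (hy : ∀ c, ∑ j, y c j ^ 2 ≤ 1)
    (hnet : ∀ (h : d → ℝ) k, ∃ c, ∑ j, h j * z k j ≤ 4 * ∑ j, h j * y c j) :
    ∫⁻ x, ⨆ k, ENNReal.ofReal (Real.exp (((η : ℤ) : ℝ) * l *
        (∑ i, |rowInner x i (z k)| - Fintype.card ι * √(2 / Real.pi))))
      ∂stdGaussianPi (ι × d) ≤
    Fintype.card Y * ENNReal.ofReal (Real.exp (32 * l ^ 2 * Fintype.card ι)) := by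
  classical
  refine (lintegral_iSup_exp_centered_le z hz _).trans ?_
  have h := Finset.sum_le_sum fun (ε : ι → ℤˣ) (_ : ε ∈ Finset.univ) =>
    lintegral_iSup_exp_sub_le z l η ε
  have hr : ∀ η' : ℤˣ, ∑ ε : ι → ℤˣ, signedMoment z l (fun i => η' * ε i) =
      ∑ ε : ι → ℤˣ, signedMoment z l ε := fun η' =>
    Equiv.sum_comp (Equiv.mulLeft (fun _ : ι => η')) (signedMoment z l)
  rw [Finset.sum_const, ← Finset.mul_sum, Finset.sum_add_distrib, hr, hr, ← two_mul, ← mul_assoc,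
    ENNReal.inv_mul_cancel (by simp) (by simp), one_mul, nsmul_eq_mul, Finset.card_univ] at h
  exact (ENNReal.mul_le_mul_iff_right (by simp) (by simp)).1
    (h.trans (sum_signedMoment_le z hl y hy hnet))

/-- One-sided tail bound for the centered `ℓ¹` process. -/
theorem measure_exists_lt_le (z : κ → d → ℝ) (hz : ∀ k, ∑ j, z k j ^ 2 = 1)
    {t : ℝ} (ht : 0 ≤ t) (η : ℤˣ) (y : Y → d → ℝ) (hy : ∀ c, ∑ j, y c j ^ 2 ≤ 1)
    (hnet : ∀ (h : d → ℝ) k, ∃ c, ∑ j, h j * z k j ≤ 4 * ∑ j, h j * y c j) :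
    stdGaussianPi (ι × d) {x | ∃ k, Fintype.card ι * t < ((η : ℤ) : ℝ) *
        (∑ i, |rowInner x i (z k)| - Fintype.card ι * √(2 / Real.pi))} ≤
    Fintype.card Y * ENNReal.ofReal (Real.exp (-(t ^ 2 * Fintype.card ι / 128))) := by
  -- Minimizes the Chernoff exponent 32l²m - lmt, with value -t²m/128.
  set l : ℝ := t / 64
  have hl : 0 ≤ l := by positivity
  set F : (ι × d → ℝ) → ENNReal := fun x => ⨆ k, ENNReal.ofReal (Real.exp (((η : ℤ) : ℝ) * l *
        (∑ i, |rowInner x i (z k)| - Fintype.card ι * √(2 / Real.pi)))) with hF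
  have hFm : Measurable F := by simp only [hF]; fun_prop
  set b : ENNReal := ENNReal.ofReal (Real.exp (l * (Fintype.card ι * t)))
  have hb : b ≠ 0 := by simp [b, Real.exp_pos]
  have hsub : {x | ∃ k, Fintype.card ι * t < ((η : ℤ) : ℝ) *
      (∑ i, |rowInner x i (z k)| - Fintype.card ι * √(2 / Real.pi))} ⊆ {x | b ≤ F x} := by
    rintro x ⟨k, hk⟩
    refine le_trans (ENNReal.ofReal_le_ofReal (Real.exp_le_exp.2 ?_))
      (le_iSup (fun k => ENNReal.ofReal (Real.exp (((η : ℤ) : ℝ) * l *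
        (∑ i, |rowInner x i (z k)| - Fintype.card ι * √(2 / Real.pi))))) k)
    rw [mul_comm _ l, mul_assoc]
    gcongr
  refine (measure_mono hsub).trans
    ((meas_ge_le_lintegral_div hFm.aemeasurable hb (by simp [b])).trans ?_)
  refine (ENNReal.div_le_div_right
    (lintegral_iSup_exp_centered_le_card_mul z hz hl η y hy hnet) _).trans (le_of_eq ?_)
  rw [mul_div_assoc, ← ENNReal.ofReal_div_of_pos (Real.exp_pos _), ← Real.exp_sub]
  congr 3
  simp only [l]
  ring

end process

/-! ### Volumetric nets and norming sets of a unit ball. -/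

section net

variable {X : Type*} [NormedAddCommGroup X] [NormedSpace ℝ X] [FiniteDimensional ℝ X]

variable (X) in
/-- The unit ball of a finite-dimensional space has a `1/2`-net of size at most `5 ^ dim`. -/
theorem exists_finset_half_net_unitBall :
    ∃ N : Finset X, N.card ≤ 5 ^ Module.finrank ℝ X ∧ (∀ u ∈ N, ‖u‖ ≤ 1) ∧
      ∀ u, ‖u‖ ≤ 1 → ∃ v ∈ N, ‖u - v‖ ≤ 1 / 2 := by
  classical
  -- A 1-separated subset of the ball of radius 2 with the most points is a 1-net of that ball;
  -- halving it gives the 1/2-net.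
  let K : Set ℕ := {k | ∃ s : Finset X, s.card = k ∧ (∀ c ∈ s, ‖c‖ ≤ 2) ∧
    ∀ c ∈ s, ∀ e ∈ s, c ≠ e → 1 ≤ ‖c - e‖}
  have hK0 : K.Nonempty := ⟨0, ∅, by simp⟩
  have hKb : ∀ k ∈ K, k ≤ 5 ^ Module.finrank ℝ X := by
    rintro k ⟨s, rfl, h1, h2⟩
    exact Besicovitch.card_le_of_separated s h1 h2
  obtain ⟨s, hs, h1, h2⟩ := Nat.sSup_mem hK0 ⟨_, hKb⟩
  have hmax : ∀ v : X, ‖v‖ ≤ 2 → ∃ c ∈ s, ‖v - c‖ < 1 := by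
    intro v hv
    by_contra! hcon
    have hvs : v ∉ s := fun h => absurd (hcon v h) (by simp)
    have hin : s.card + 1 ∈ K := by
      refine ⟨insert v s, Finset.card_insert_of_notMem hvs, ?_, ?_⟩
      · intro c hc
        rcases Finset.mem_insert.1 hc with rfl | hc
        exacts [hv, h1 c hc]
      · intro c hc e he hce
        rcases Finset.mem_insert.1 hc with rfl | hc' <;>
          rcases Finset.mem_insert.1 he with rfl | he'
        · exact absurd rfl hce
        · exact hcon e he'
        · rw [norm_sub_rev]
          exact hcon c hc'
        · exact h2 c hc' e he' hce
    have := le_csSup ⟨_, hKb⟩ hin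
    omega
  refine ⟨s.image fun c => (1 / 2 : ℝ) • c, Finset.card_image_le.trans (hKb _ ⟨s, rfl, h1, h2⟩),
    ?_, ?_⟩
  · simp only [Finset.mem_image, forall_exists_index, and_imp, forall_apply_eq_imp_iff₂]
    intro c hc
    rw [norm_smul]
    norm_num
    linarith [h1 c hc]
  · intro u hu
    obtain ⟨c, hc, hlt⟩ := hmax ((2 : ℝ) • u) (by rw [norm_smul]; norm_num; linarith)
    refine ⟨_, Finset.mem_image_of_mem _ hc, ?_⟩
    have : u - (1 / 2 : ℝ) • c = (1 / 2 : ℝ) • ((2 : ℝ) • u - c) := by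
      rw [smul_sub, smul_smul]; norm_num
    rw [this, norm_smul]
    norm_num
    linarith

variable (X) in
/-- Finitely many points of the unit ball norm every linear functional up to a factor `2`. -/
theorem exists_finset_norming_unitBall :
    ∃ N : Finset X, N.card ≤ 5 ^ Module.finrank ℝ X ∧ (∀ u ∈ N, ‖u‖ ≤ 1) ∧
      ∀ (φ : X →ₗ[ℝ] ℝ) (u : X), ‖u‖ ≤ 1 → ∃ v ∈ N, φ u ≤ 2 * φ v := by
  obtain ⟨N, hc, h1, hnet⟩ := exists_finset_half_net_unitBall X
  refine ⟨N, hc, h1, fun φ u hu => ?_⟩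
  obtain ⟨v₀, hv₀, -⟩ := hnet 0 (by simp)
  obtain ⟨v, hv, hmax⟩ := N.exists_max_image φ ⟨v₀, hv₀⟩
  refine ⟨v, hv, ?_⟩
  set f := LinearMap.toContinuousLinearMap φ with hf
  have hφ : ∀ x, φ x = f x := fun x => rfl
  have hb : ∀ x, ‖x‖ ≤ 1 → f x ≤ φ v + ‖f‖ / 2 := by
    intro x hx
    obtain ⟨c, hcN, hxc⟩ := hnet x hx
    have h3 : f x = f c + f (x - c) := by rw [map_sub]; ring
    have h4 : f (x - c) ≤ ‖f‖ * (1 / 2) :=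
      (le_abs_self _).trans ((f.le_opNorm _).trans (by gcongr))
    have h5 := hmax c hcN
    rw [hφ c] at h5
    linarith
  -- Absorbing ‖f‖ / 2 gives ‖f‖ ≤ 2 φ v at the maximizer v of φ on the net.
  have hn : ‖f‖ ≤ φ v + ‖f‖ / 2 := by
    refine ContinuousLinearMap.opNorm_le_of_unit_norm ?_ fun x hx => ?_
    · simpa using hb 0 (by simp)
    · refine abs_le'.2 ⟨hb x hx.le, ?_⟩
      simpa using hb (-x) (by simp [hx])
  have := (le_abs_self (f u)).trans (f.le_opNorm u)
  have h6 : ‖f‖ * ‖u‖ ≤ ‖f‖ * 1 := by gcongr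
  rw [hφ u]
  linarith

end net

/-! ### Factorization of low-rank blocks and their norming set. -/

/-- A space of dimension at most `r` embeds isometrically in `ℝ^r`. -/
theorem exists_linearIsometry_euclideanSpace {V : Type*} [NormedAddCommGroup V]
    [InnerProductSpace ℝ V] [FiniteDimensional ℝ V] {r : ℕ} (h : Module.finrank ℝ V ≤ r) :
    Nonempty (V →ₗᵢ[ℝ] EuclideanSpace ℝ (Fin r)) := by
  let b := stdOrthonormalBasis ℝ V
  let c := EuclideanSpace.basisFun (Fin r) ℝ
  let f := b.toBasis.constr ℝ fun i => c (Fin.castLE h i)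
  refine ⟨f.isometryOfOrthonormal (v := b.toBasis) (by simp) ?_⟩
  have : f ∘ b.toBasis = c ∘ Fin.castLE h := by
    funext i
    simp [f]
  rw [this]
  exact c.orthonormal.comp _ (Fin.castLE_injective h)

/-- A family of vectors spanning a space of dimension at most `r` factors through `ℝ^r`: it is the
image of a family with the same norms under a contraction. -/
theorem exists_contraction_factorization {E β : Type*} [NormedAddCommGroup E]
    [InnerProductSpace ℝ E] [FiniteDimensional ℝ E] {r : ℕ} (v : β → E)
    (h : Module.finrank ℝ (Submodule.span ℝ (Set.range v)) ≤ r) :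
    ∃ (U : EuclideanSpace ℝ (Fin r) →L[ℝ] E) (w : β → EuclideanSpace ℝ (Fin r)),
      ‖U‖ ≤ 1 ∧ (∀ b, ‖w b‖ = ‖v b‖) ∧ ∀ b, U (w b) = v b := by
  obtain ⟨i⟩ := exists_linearIsometry_euclideanSpace h
  set V := Submodule.span ℝ (Set.range v)
  let j := i.toContinuousLinearMap
  have hj : ‖j‖ ≤ 1 := i.norm_toContinuousLinearMap_le
  -- The adjoint of an isometry is a contraction and a left inverse of it.
  refine ⟨V.subtypeL ∘L ContinuousLinearMap.adjoint j,
    fun b => i ⟨v b, Submodule.subset_span ⟨b, rfl⟩⟩, ?_, ?_, ?_⟩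
  · refine (ContinuousLinearMap.opNorm_comp_le _ _).trans ?_
    rw [LinearIsometryEquiv.norm_map]
    exact mul_le_one₀ (Submodule.norm_subtypeL_le V) (norm_nonneg _) hj
  · intro b
    simp
  · intro b
    have h1 : ContinuousLinearMap.adjoint j ∘L j = ContinuousLinearMap.id ℝ V :=
      (ContinuousLinearMap.norm_map_iff_adjoint_comp_self j).1 fun x => i.norm_map x
    have h2 := DFunLike.congr_fun h1 ⟨v b, Submodule.subset_span ⟨b, rfl⟩⟩
    exact congrArg Subtype.val h2

/-- The matrix, as a function of its entries, supported on `range f × range g`, whose columns are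
the images of the vectors `w b` under `U`. -/
noncomputable def blockProduct {n s r : ℕ} (f g : Fin s → Fin n)
    (U : EuclideanSpace ℝ (Fin r) →L[ℝ] EuclideanSpace ℝ (Fin s))
    (w : PiLp 2 fun _ : Fin s => EuclideanSpace ℝ (Fin r)) : Fin n × Fin n → ℝ :=
  Function.extend (Prod.map f g) (fun p => U (w p.2) p.1) 0

theorem sum_mul_blockProduct {n s r : ℕ} {f g : Fin s → Fin n} (hf : f.Injective)
    (hg : g.Injective) (h : Fin n × Fin n → ℝ)
    (U : EuclideanSpace ℝ (Fin r) →L[ℝ] EuclideanSpace ℝ (Fin s))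
    (w : PiLp 2 fun _ : Fin s => EuclideanSpace ℝ (Fin r)) :
    ∑ p, h p * blockProduct f g U w p = ∑ b, ∑ a, h (f a, g b) * U (w b) a := by
  have hfg := hf.prodMap hg
  rw [← Fintype.sum_of_injective (Prod.map f g) hfg
    (fun p => h (f p.1, g p.2) * U (w p.2) p.1), Fintype.sum_prod_type_right]
  · intro p hp
    simp [blockProduct, Function.extend_apply' _ _ _ hp]
  · intro p
    rw [blockProduct, hfg.extend_apply]
    rfl

theorem sum_sq_blockProduct_le {n s r : ℕ} {f g : Fin s → Fin n} (hf : f.Injective)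
    (hg : g.Injective) {U : EuclideanSpace ℝ (Fin r) →L[ℝ] EuclideanSpace ℝ (Fin s)}
    (hU : ‖U‖ ≤ 1) {w : PiLp 2 fun _ : Fin s => EuclideanSpace ℝ (Fin r)} (hw : ‖w‖ ≤ 1) :
    ∑ p, blockProduct f g U w p ^ 2 ≤ 1 := by
  have hfg := hf.prodMap hg
  simp_rw [sq]
  rw [sum_mul_blockProduct hf hg]
  calc ∑ b, ∑ a, blockProduct f g U w (f a, g b) * U (w b) a
      = ∑ b, ‖U (w b)‖ ^ 2 := by
        refine Finset.sum_congr rfl fun b _ => ?_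
        rw [EuclideanSpace.real_norm_sq_eq]
        refine Finset.sum_congr rfl fun a _ => ?_
        rw [blockProduct, ← Prod.map_apply, hfg.extend_apply, sq]
    _ ≤ ∑ b, ‖w b‖ ^ 2 := by
        refine Finset.sum_le_sum fun b _ => ?_
        have := U.le_of_opNorm_le hU (w b)
        rw [one_mul] at this
        gcongr
    _ = ‖w‖ ^ 2 := (PiLp.norm_sq_eq_of_L2 _ w).symm
    _ ≤ 1 := pow_le_one₀ (norm_nonneg _) hw

theorem finrank_span_submatrix_col_le {n s : ℕ} (Z : Matrix (Fin n) (Fin n) ℝ)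
    (f g : Fin s → Fin n) :
    Module.finrank ℝ (Submodule.span ℝ (Set.range fun b =>
      (WithLp.toLp 2 fun a => Z (f a) (g b) : EuclideanSpace ℝ (Fin s)))) ≤ Z.rank := by
  let R : (Fin n → ℝ) →ₗ[ℝ] EuclideanSpace ℝ (Fin s) :=
    (WithLp.linearEquiv 2 ℝ (Fin s → ℝ)).symm.toLinearMap ∘ₗ LinearMap.funLeft ℝ ℝ f
  have hle : Submodule.span ℝ (Set.range fun b =>
      (WithLp.toLp 2 fun a => Z (f a) (g b) : EuclideanSpace ℝ (Fin s))) ≤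
      (Submodule.span ℝ (Set.range Z.col)).map R := by
    refine Submodule.span_le.2 ?_
    rintro _ ⟨b, rfl⟩
    exact ⟨Z.col (g b), Submodule.subset_span ⟨g b, rfl⟩, rfl⟩
  rw [Matrix.rank_eq_finrank_span_cols]
  exact (Submodule.finrank_mono hle).trans (Submodule.finrank_map_le _ _)

theorem exists_blockProduct_eq {n s r : ℕ} {Z : Matrix (Fin n) (Fin n) ℝ} (hr : Z.rank ≤ r)
    (hZ : ∑ p : Fin n × Fin n, Z p.1 p.2 ^ 2 ≤ 1) {f g : Fin s → Fin n} (hf : f.Injective)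
    (hg : g.Injective) (hzf : ∀ i, i ∉ Set.range f → ∀ j, Z i j = 0)
    (hzg : ∀ i j, j ∉ Set.range g → Z i j = 0) :
    ∃ (U : EuclideanSpace ℝ (Fin r) →L[ℝ] EuclideanSpace ℝ (Fin s))
      (w : PiLp 2 fun _ : Fin s => EuclideanSpace ℝ (Fin r)),
      ‖U‖ ≤ 1 ∧ ‖w‖ ≤ 1 ∧ blockProduct f g U w = fun p => Z p.1 p.2 := by
  obtain ⟨U, w, hU, hw, hUw⟩ := exists_contraction_factorization
    (fun b => (WithLp.toLp 2 fun a => Z (f a) (g b) : EuclideanSpace ℝ (Fin s)))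
    ((finrank_span_submatrix_col_le Z f g).trans hr)
  have hfg := hf.prodMap hg
  refine ⟨U, WithLp.toLp 2 w, hU, ?_, ?_⟩
  · rw [← sq_le_one_iff₀ (norm_nonneg _), PiLp.norm_sq_eq_of_L2]
    refine le_trans (le_of_eq ?_) hZ
    rw [← Fintype.sum_of_injective (Prod.map f g) hfg (fun p => Z (f p.1) (g p.2) ^ 2),
      Fintype.sum_prod_type_right]
    · refine Finset.sum_congr rfl fun b _ => ?_
      simp [hw, EuclideanSpace.real_norm_sq_eq]
    · rintro ⟨i, j⟩ hp
      rw [Set.range_prodMap, Set.mem_prod, not_and_or] at hp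
      rcases hp with h | h
      · simp [hzf i h j]
      · simp [hzg i j h]
    · intro p
      rfl
  · funext p
    by_cases hp : p ∈ Set.range (Prod.map f g)
    · obtain ⟨⟨a, b⟩, rfl⟩ := hp
      rw [blockProduct, hfg.extend_apply]
      simp [hUw]
    · rw [blockProduct, Function.extend_apply' _ _ _ hp]
      obtain ⟨i, j⟩ := p
      rw [Set.range_prodMap, Set.mem_prod, not_and_or] at hp
      rcases hp with h | h
      · simp [hzf i h j]
      · simp [hzg i j h]

/-- The pairing is bilinear in (U, w): first replace U with w fixed, then w with the new U fixed,
losing 2 · 2 = 4. Both parameter spaces have dimension sr. -/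
theorem exists_norming_blockProduct (n s r : ℕ) :
    ∃ (K : Type) (_ : Fintype K)
      (u : K → EuclideanSpace ℝ (Fin r) →L[ℝ] EuclideanSpace ℝ (Fin s))
      (v : K → PiLp 2 fun _ : Fin s => EuclideanSpace ℝ (Fin r)),
      Fintype.card K ≤ 5 ^ (2 * (s * r)) ∧ (∀ k, ‖u k‖ ≤ 1) ∧ (∀ k, ‖v k‖ ≤ 1) ∧
      ∀ f g : Fin s → Fin n, f.Injective → g.Injective →
        ∀ (U : EuclideanSpace ℝ (Fin r) →L[ℝ] EuclideanSpace ℝ (Fin s))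
          (w : PiLp 2 fun _ : Fin s => EuclideanSpace ℝ (Fin r)), ‖U‖ ≤ 1 → ‖w‖ ≤ 1 →
        ∀ h : Fin n × Fin n → ℝ, ∃ k,
          ∑ p, h p * blockProduct f g U w p ≤ 4 * ∑ p, h p * blockProduct f g (u k) (v k) p := by
  obtain ⟨N, hN, hN1, hNn⟩ := exists_finset_norming_unitBall
    (EuclideanSpace ℝ (Fin r) →L[ℝ] EuclideanSpace ℝ (Fin s))
  obtain ⟨M, hM, hM1, hMn⟩ := exists_finset_norming_unitBall
    (PiLp 2 fun _ : Fin s => EuclideanSpace ℝ (Fin r))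
  have hNd : Module.finrank ℝ (EuclideanSpace ℝ (Fin r) →L[ℝ] EuclideanSpace ℝ (Fin s)) =
      s * r := by
    rw [← LinearMap.toContinuousLinearMap.finrank_eq, Module.finrank_linearMap,
      finrank_euclideanSpace_fin, finrank_euclideanSpace_fin, mul_comm]
  have hMd : Module.finrank ℝ (PiLp 2 fun _ : Fin s => EuclideanSpace ℝ (Fin r)) = s * r := by
    rw [(WithLp.linearEquiv 2 ℝ (Fin s → EuclideanSpace ℝ (Fin r))).finrank_eq,
      Module.finrank_pi_fintype]
    simp
  rw [hNd] at hN
  rw [hMd] at hM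
  have hcard : Fintype.card (N × M) ≤ 5 ^ (2 * (s * r)) := by
    rw [Fintype.card_prod, Fintype.card_coe, Fintype.card_coe, two_mul, pow_add]
    gcongr
  refine ⟨N × M, inferInstance, fun k => k.1.1, fun k => k.2.1, hcard, fun k => hN1 _ k.1.2,
    fun k => hM1 _ k.2.2, fun f g hf hg U w hU hw h => ?_⟩
  simp only [sum_mul_blockProduct hf hg]
  let φ : (EuclideanSpace ℝ (Fin r) →L[ℝ] EuclideanSpace ℝ (Fin s)) →ₗ[ℝ] ℝ :=
    { toFun := fun U => ∑ b, ∑ a, h (f a, g b) * U (w b) a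
      map_add' := fun U V => by
        simp only [_root_.add_apply, PiLp.add_apply, mul_add, Finset.sum_add_distrib]
      map_smul' := fun c U => by
        simp only [_root_.smul_apply, PiLp.smul_apply, smul_eq_mul, mul_left_comm,
          Finset.mul_sum, RingHom.id_apply] }
  obtain ⟨u, hu, hle⟩ := hNn φ U hU
  let ψ : (PiLp 2 fun _ : Fin s => EuclideanSpace ℝ (Fin r)) →ₗ[ℝ] ℝ :=
    { toFun := fun w => ∑ b, ∑ a, h (f a, g b) * u (w b) a
      map_add' := fun U V => by
        simp only [PiLp.add_apply, map_add, mul_add, Finset.sum_add_distrib]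
      map_smul' := fun c U => by
        simp only [PiLp.smul_apply, map_smul, smul_eq_mul, mul_left_comm,
          Finset.mul_sum, RingHom.id_apply] }
  obtain ⟨v, hv, hle'⟩ := hMn ψ w hw
  refine ⟨(⟨u, hu⟩, ⟨v, hv⟩), ?_⟩
  have e : φ u = ψ w := rfl
  change φ U ≤ 4 * ψ v
  linarith

theorem exists_embeddings_onto_card (n s : ℕ) :
    ∃ (I : Type) (_ : Fintype I) (e : I → Fin s → Fin n), Fintype.card I = n.choose s ∧
      (∀ S, (e S).Injective) ∧ ∀ S : Finset (Fin n), S.card = s → ∃ i, Set.range (e i) = S := by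
  refine ⟨{S : Finset (Fin n) // S.card = s}, inferInstance,
    fun S => S.1.orderEmbOfFin S.2, by simp, fun S => (S.1.orderEmbOfFin S.2).injective,
    fun S hS => ⟨⟨S, hS⟩, Finset.range_orderEmbOfFin _ _⟩⟩

/-- Finitely many matrices of Frobenius norm at most `1` control every linear functional on the
unit ball of `bisparseLowRank n s r`, up to a factor `4`. -/
theorem exists_norming_bisparseLowRank (n s r : ℕ) :
    ∃ (Y : Type) (_ : Fintype Y) (y : Y → Fin n × Fin n → ℝ),
      Fintype.card Y ≤ n.choose s ^ 2 * 5 ^ (2 * (s * r)) ∧ (∀ c, ∑ p, y c p ^ 2 ≤ 1) ∧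
      ∀ Z ∈ bisparseLowRank n s r, ∑ p : Fin n × Fin n, Z p.1 p.2 ^ 2 ≤ 1 →
        ∀ h : Fin n × Fin n → ℝ, ∃ c, ∑ p, h p * Z p.1 p.2 ≤ 4 * ∑ p, h p * y c p := by
  obtain ⟨K, _, u, v, hK, hu, hv, huv⟩ := exists_norming_blockProduct n s r
  obtain ⟨I, _, e, hI, he, hrange⟩ := exists_embeddings_onto_card n s
  refine ⟨(I × I) × K, inferInstance, fun c => blockProduct (e c.1.1) (e c.1.2) (u c.2) (v c.2),
    ?_, fun c => sum_sq_blockProduct_le (he _) (he _) (hu _) (hv _), ?_⟩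
  · rw [Fintype.card_prod, Fintype.card_prod, hI, ← sq]
    gcongr
  · rintro Z ⟨hr, S, T, hS, hT, hZS, hZT⟩ hZ h
    obtain ⟨S', hS'⟩ := hrange S hS
    obtain ⟨T', hT'⟩ := hrange T hT
    obtain ⟨U, w, hU, hw, hUw⟩ := exists_blockProduct_eq hr hZ (he S') (he T')
      (fun i hi j => hZS i (by rwa [hS', Finset.mem_coe] at hi) j)
      (fun i j hj => hZT i j (by rwa [hT', Finset.mem_coe] at hj))
    obtain ⟨k, hle⟩ := huv _ _ (he S') (he T') U w hU hw h
    refine ⟨((S', T'), k), ?_⟩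
    rwa [hUw] at hle

/-! ### Cardinality estimate, normalization and passage to the full set of matrices. -/

/-- The bound is (en/s)^s, from binom(n,s) ≤ n^s/s! and s^s/s! ≤ e^s. -/
theorem choose_le_exp {n s : ℕ} (hs : 1 ≤ s) (hsn : s ≤ n) :
    (n.choose s : ℝ) ≤ Real.exp (s * Real.log (Real.exp 1 * n / s)) := by
  have hs0 : (0 : ℝ) < s := by exact_mod_cast hs
  have hn0 : (0 : ℝ) < n := by exact_mod_cast hs.trans hsn
  have hf : (0 : ℝ) < s.factorial := by exact_mod_cast s.factorial_pos
  rw [mul_comm, ← Real.rpow_def_of_pos (by positivity), Real.rpow_natCast]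
  refine (Nat.choose_le_pow_div s n).trans ?_
  have h := Real.pow_div_factorial_le_exp (s : ℝ) hs0.le s
  rw [div_le_iff₀ hf] at h ⊢
  rw [div_pow, mul_pow, ← Real.exp_nat_mul, mul_one, div_mul_eq_mul_div,
    le_div_iff₀ (by positivity)]
  calc (n : ℝ) ^ s * s ^ s ≤ n ^ s * (Real.exp s * s.factorial) := by gcongr
    _ = _ := by ring

theorem smul_mem_bisparseLowRank {n s r : ℕ} {Z : Matrix (Fin n) (Fin n) ℝ}
    (hZ : Z ∈ bisparseLowRank n s r) (a : ℝ) : a • Z ∈ bisparseLowRank n s r := by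
  obtain ⟨hr, S, T, hS, hT, hZS, hZT⟩ := hZ
  refine ⟨?_, S, T, hS, hT, fun i hi j => ?_, fun i j hj => ?_⟩
  · rw [show a • Z = Z * (a • 1) by simp]
    exact (Matrix.rank_mul_le_left _ _).trans hr
  · simp [hZS i hi j]
  · simp [hZT i j hj]

theorem frobenius_norm_sq_eq_sum {n : ℕ} (Z : Matrix (Fin n) (Fin n) ℝ) :
    ‖Z‖ ^ 2 = ∑ p : Fin n × Fin n, Z p.1 p.2 ^ 2 := by
  rw [Matrix.frobenius_norm_def, ← Real.rpow_natCast, ← Real.rpow_mul (by positivity)]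
  simp [Fintype.sum_prod_type]

theorem norm_toLp_one_sensingMap {n m : ℕ} (x : Fin m × Fin n × Fin n → ℝ)
    (Z : Matrix (Fin n) (Fin n) ℝ) :
    ‖WithLp.toLp 1 (sensingMap (fun i => Matrix.of fun k l => x (i, k, l)) Z)‖ =
      ∑ i, |rowInner x i fun p => Z p.1 p.2| := by
  rw [PiLp.norm_eq_of_L1]
  refine Finset.sum_congr rfl fun i _ => ?_
  rw [Real.norm_eq_abs]
  congr 1
  simp only [sensingMap, LinearMap.coe_mk, AddHom.coe_mk, rowInner, Fintype.sum_prod_type,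
    Matrix.trace, Matrix.diag, Matrix.mul_apply, Matrix.transpose_apply, Matrix.of_apply]
  exact Finset.sum_comm

/-- The entries of the unit-norm matrices in `bisparseLowRank n s r`. -/
def unitBisparse (n s r : ℕ) : Set (Fin n × Fin n → ℝ) :=
  {z | (Matrix.of fun i j => z (i, j)) ∈ bisparseLowRank n s r ∧ ∑ p, z p ^ 2 = 1}

theorem satisfiesRIP_of_forall_unitBisparse {n m s r : ℕ} (hm : 0 < m) {δ : ℝ}
    (x : Fin m × Fin n × Fin n → ℝ)
    (h : ∀ z ∈ unitBisparse n s r, |∑ i, |rowInner x i z| - m * √(2 / Real.pi)| ≤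
      m * (δ * √(2 / Real.pi))) :
    SatisfiesRIP (sensingMap fun i => Matrix.of fun k l => x (i, k, l)) s r δ := by
  intro Z hZ
  rw [norm_toLp_one_sensingMap]
  rcases eq_or_ne Z 0 with rfl | hZ0
  · simp [rowInner]
  have hn : 0 < ‖Z‖ := norm_pos_iff.2 hZ0
  set z : Fin n × Fin n → ℝ := fun p => ‖Z‖⁻¹ * Z p.1 p.2 with hz
  have hzu : z ∈ unitBisparse n s r := by
    refine ⟨smul_mem_bisparseLowRank hZ ‖Z‖⁻¹, ?_⟩
    simp only [hz, mul_pow]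
    rw [← Finset.mul_sum, ← frobenius_norm_sq_eq_sum]
    field_simp
  have hrow : ∑ i, |rowInner x i fun p => Z p.1 p.2| = ‖Z‖ * ∑ i, |rowInner x i z| := by
    rw [Finset.mul_sum]
    refine Finset.sum_congr rfl fun i _ => ?_
    have : (rowInner x i fun p => Z p.1 p.2) = ‖Z‖ * rowInner x i z := by
      simp only [rowInner, Finset.mul_sum, hz]
      refine Finset.sum_congr rfl fun p _ => ?_
      field_simp
    rw [this, abs_mul, abs_of_pos hn]
  rw [hrow]
  obtain ⟨h1, h2⟩ := abs_le.1 (h z hzu)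
  set σ := ∑ i, |rowInner x i z|
  have hm' : (0 : ℝ) < m := by exact_mod_cast hm
  have hp : √(Real.pi / 2) * √(2 / Real.pi) = 1 := by
    rw [← Real.sqrt_mul (by positivity)]
    have := Real.pi_pos
    field_simp
    simp
  have hk : 0 < √(Real.pi / 2) := Real.sqrt_pos.2 (by positivity)
  have e : ∀ a : ℝ, a * ‖Z‖ = √(Real.pi / 2) / m * (‖Z‖ * (m * (a * √(2 / Real.pi)))) := by
    intro a
    field_simp
    linear_combination (-a) * hp
  rw [e (1 - δ), e (1 + δ)]
  constructor <;> gcongr <;> linarith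

theorem exists_measurableSet_forall_unitBisparse (n m s r : ℕ) {t : ℝ} (ht : 0 ≤ t) :
    ∃ B : Set (Fin m × Fin n × Fin n → ℝ), MeasurableSet B ∧
      stdGaussianPi (Fin m × Fin n × Fin n) B ≤ 2 * ENNReal.ofReal
        (((n.choose s : ℝ) ^ 2 * 5 ^ (2 * (s * r))) * Real.exp (-(t ^ 2 * m / 128))) ∧
      ∀ x ∉ B, ∀ z ∈ unitBisparse n s r, |∑ i, |rowInner x i z| - m * √(2 / Real.pi)| ≤ m * t := by
  -- Countability gives measurability of the supremum; the tail bound does not depend on D, and the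
  -- deviation condition is closed, so it extends from D to all of `unitBisparse n s r`.
  obtain ⟨D, hDc, hD⟩ := TopologicalSpace.exists_countable_dense (unitBisparse n s r)
  have : Countable D := hDc
  obtain ⟨Y, _, y, hY, hy, hnet⟩ := exists_norming_bisparseLowRank n s r
  let B : ℤˣ → Set (Fin m × Fin n × Fin n → ℝ) := fun η => {x | ∃ k : D, (m : ℝ) * t <
    ((η : ℤ) : ℝ) * (∑ i, |rowInner x i k.1.1| - m * √(2 / Real.pi))}
  have hBm : ∀ η, MeasurableSet (B η) := by
    intro η
    have : B η = ⋃ k : D, {x | (m : ℝ) * t <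
        ((η : ℤ) : ℝ) * (∑ i, |rowInner x i k.1.1| - m * √(2 / Real.pi))} := by
      ext x; simp [B]
    rw [this]
    exact MeasurableSet.iUnion fun k => measurableSet_lt (by fun_prop) (by fun_prop)
  have hB : ∀ η, stdGaussianPi (Fin m × Fin n × Fin n) (B η) ≤ ENNReal.ofReal
        (((n.choose s : ℝ) ^ 2 * 5 ^ (2 * (s * r))) * Real.exp (-(t ^ 2 * m / 128))) := by
    intro η
    have h := measure_exists_lt_le (ι := Fin m) (fun k : D => k.1.1) (fun k => k.1.2.2) ht η y hy
      (fun h k => hnet _ k.1.2.1 k.1.2.2.le h)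
    rw [Fintype.card_fin] at h
    refine h.trans ?_
    rw [ENNReal.ofReal_mul (by positivity), ← ENNReal.ofReal_natCast]
    gcongr
    exact_mod_cast hY
  refine ⟨B 1 ∪ B (-1), (hBm _).union (hBm _), ?_, fun x hx => ?_⟩
  · rw [two_mul]
    exact (measure_union_le _ _).trans (add_le_add (hB _) (hB _))
  · simp only [Set.mem_union, not_or] at hx
    have hdense : DenseRange fun k : D => k.1 := by
      simpa [DenseRange] using hD
    have hclosed : IsClosed {z : unitBisparse n s r |
        |∑ i, |rowInner x i z.1| - m * √(2 / Real.pi)| ≤ m * t} := by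
      have hc : ∀ i, Continuous fun z : unitBisparse n s r => rowInner x i z.1 := fun i =>
        continuous_finsetSum _ fun k _ =>
          continuous_const.mul ((continuous_apply k).comp continuous_subtype_val)
      exact isClosed_le ((continuous_finsetSum _ fun i _ => (hc i).abs).sub continuous_const).abs
        continuous_const
    have := isClosed_property hdense hclosed fun k => by
      refine abs_le'.2 ⟨?_, ?_⟩
      · by_contra! hcon
        exact hx.1 ⟨k, by simpa using hcon⟩
      · by_contra! hcon
        exact hx.2 ⟨k, by simpa using hcon⟩
    exact fun z hz => this ⟨z, hz⟩

theorem IsGaussianSensing.map_eq {Ω : Type*} [MeasurableSpace Ω] {μ : Measure Ω}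
    [IsProbabilityMeasure μ] {n m : ℕ} {A : Fin m → Ω → Matrix (Fin n) (Fin n) ℝ}
    (hA : IsGaussianSensing μ A) :
    μ.map (fun ω (q : Fin m × Fin n × Fin n) => A q.1 ω q.2.1 q.2.2) = stdGaussianPi _ := by
  refine (hA.indep.map_fun_eq_pi_map fun (q : Fin m × Fin n × Fin n) =>
    (hA.hasLaw q.1 q.2.1 q.2.2).aemeasurable).trans ?_
  congr 1
  funext q
  exact (hA.hasLaw q.1 q.2.1 q.2.2).map_eq

/-- The 6 is 2 + 4: two support choices, and 5 ≤ e² raised to 2sr. Both are absorbed into rs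
ln(en/s) since r ≥ 1 and ln(en/s) ≥ 1. -/
theorem choose_sq_mul_five_pow_le_exp {n s r : ℕ} (hs : 1 ≤ s) (hsn : s ≤ n) (hr : 1 ≤ r) :
    (n.choose s : ℝ) ^ 2 * 5 ^ (2 * (s * r)) ≤
      Real.exp (6 * (r * s * Real.log (Real.exp 1 * n / s))) := by
  have hs0 : (0 : ℝ) < s := by exact_mod_cast hs
  have hsn' : (s : ℝ) ≤ n := by exact_mod_cast hsn
  have hr' : (1 : ℝ) ≤ r := by exact_mod_cast hr
  have hl : 1 ≤ Real.log (Real.exp 1 * n / s) := by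
    rw [Real.le_log_iff_exp_le (by have := hs0.trans_le hsn'; positivity), le_div_iff₀ hs0]
    gcongr
  set l := Real.log (Real.exp 1 * n / s)
  have h5 : (5 : ℝ) ≤ Real.exp 2 := by
    have h := Real.exp_one_gt_d9
    rw [show (2 : ℝ) = 1 + 1 by norm_num, Real.exp_add]
    nlinarith
  calc (n.choose s : ℝ) ^ 2 * 5 ^ (2 * (s * r))
      ≤ Real.exp (s * l) ^ 2 * Real.exp 2 ^ (2 * (s * r)) := by
        gcongr
        exact choose_le_exp hs hsn
    _ = Real.exp (2 * (s * l) + 4 * (s * r)) := by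
        rw [← Real.exp_nat_mul, ← Real.exp_nat_mul, ← Real.exp_add]
        congr 1
        push_cast
        ring
    _ ≤ _ := by
        refine Real.exp_le_exp.2 ?_
        have h1 : s * l ≤ r * (s * l) := le_mul_of_one_le_left (by positivity) hr'
        have h2 : (s : ℝ) * r ≤ s * r * l := le_mul_of_one_le_right (by positivity) hl
        linarith

/-- Holds because 1 ≤ 2 ln 2 ≤ 2 ln(n/s); this reduces case (a) to case (b). -/
theorem log_exp_one_mul_div_le {n s : ℕ} (hs : 1 ≤ s) (hsn : 2 * s ≤ n) :
    Real.log (Real.exp 1 * n / s) ≤ 3 * Real.log ((n : ℝ) / s) := by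
  have hs0 : (0 : ℝ) < s := by exact_mod_cast hs
  have hsn' : (2 : ℝ) * s ≤ n := by exact_mod_cast hsn
  have hns : (2 : ℝ) ≤ n / s := by rwa [le_div_iff₀ hs0]
  rw [mul_div_assoc, Real.log_mul (Real.exp_pos 1).ne' (by positivity), Real.log_exp]
  have := Real.log_le_log (by norm_num) hns
  linarith [Real.log_two_gt_d9]

/-! ### Choice of constants and conclusion. -/

theorem mainTheorem6 :
    ∃ C > (0 : ℝ), ∃ c > (0 : ℝ),
      ∀ {Ω : Type*} [MeasurableSpace Ω] (μ : Measure Ω) [IsProbabilityMeasure μ]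
        (n m s r : ℕ) (A : Fin m → Ω → Matrix (Fin n) (Fin n) ℝ) (δ : ℝ),
        IsGaussianSensing μ A → 1 ≤ s → s ≤ n → 1 ≤ r → 0 < δ → δ < 1 →
        ((2 * s ≤ n ∧ C / δ ^ 2 * (r * s * Real.log ((n : ℝ) / s)) ≤ (m : ℝ)) ∨
          C / δ ^ 2 * (r * s * Real.log (Real.exp 1 * n / s)) ≤ (m : ℝ)) →
        1 - 2 * Real.exp (-(c * δ ^ 2 * m)) ≤
          μ.real {ω | SatisfiesRIP (sensingMap fun i => A i ω) s r δ} := by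
  have hpi := Real.pi_pos
  -- With t = δ√(2/π) the tail exponent t²m/128 is δ²m/(64π). Half of it, δ²m/(128π), is the final
  -- rate; the other half must dominate 6rs ln(en/s), which needs 768π = 6 · 128π. The remaining
  -- factor 3 in 2304π pays for case (a).
  refine ⟨2304 * Real.pi, by positivity, 1 / (128 * Real.pi), by positivity, ?_⟩
  intro Ω _ μ _ n m s r A δ hA hs hsn hr hδ _ hm
  have hs0 : (0 : ℝ) < s := by exact_mod_cast hs
  have hr0 : (0 : ℝ) < r := by exact_mod_cast hr
  have hL : 768 * Real.pi * (r * s * Real.log (Real.exp 1 * n / s)) ≤ δ ^ 2 * m := by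
    have hl0 : 0 ≤ Real.log (Real.exp 1 * n / s) := by
      refine Real.log_nonneg ?_
      rw [le_div_iff₀ hs0, one_mul]
      have h1 : (s : ℝ) ≤ n := by exact_mod_cast hsn
      nlinarith [Real.one_le_exp (zero_le_one (α := ℝ))]
    rcases hm with ⟨h2, hm⟩ | hm
    · rw [div_mul_eq_mul_div, div_le_iff₀ (by positivity)] at hm
      calc 768 * Real.pi * (r * s * Real.log (Real.exp 1 * n / s))
          ≤ 768 * Real.pi * (r * s * (3 * Real.log ((n : ℝ) / s))) := by
            gcongr
            exact log_exp_one_mul_div_le hs h2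
        _ ≤ δ ^ 2 * m := by linarith
    · rw [div_mul_eq_mul_div, div_le_iff₀ (by positivity)] at hm
      have : 0 ≤ Real.pi * (r * s * Real.log (Real.exp 1 * n / s)) := by positivity
      linarith
  have hcard := choose_sq_mul_five_pow_le_exp hs hsn hr
  -- The rescaling by 1/m needs m ≠ 0; the sample-size bound rules out m = 0 since ln(en/s) ≥ 1.
  have hm0 : 0 < m := by
    rcases Nat.eq_zero_or_pos m with rfl | h
    · have h1 : (1 : ℝ) ≤ Real.log (Real.exp 1 * n / s) := by
        have h1 : (s : ℝ) ≤ n := by exact_mod_cast hsn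
        rw [Real.le_log_iff_exp_le (by have := hs0.trans_le h1; positivity), le_div_iff₀ hs0]
        gcongr
      have : 0 < 768 * Real.pi * (r * s * Real.log (Real.exp 1 * n / s)) := by positivity
      simp at hL
      linarith
    · exact h
  obtain ⟨B, hBm, hB, hgood⟩ := exists_measurableSet_forall_unitBisparse n m s r
    (t := δ * √(2 / Real.pi)) (by positivity)
  have hBr : (stdGaussianPi (Fin m × Fin n × Fin n)).real B ≤
      2 * Real.exp (-(1 / (128 * Real.pi) * δ ^ 2 * m)) := by
    refine ENNReal.toReal_le_of_le_ofReal (by positivity) (hB.trans ?_)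
    rw [ENNReal.ofReal_mul zero_le_two, ENNReal.ofReal_ofNat]
    gcongr
    refine (mul_le_mul_of_nonneg_right hcard (Real.exp_pos _).le).trans ?_
    rw [← Real.exp_add, mul_pow, Real.sq_sqrt (by positivity)]
    refine Real.exp_le_exp.2 ?_
    field_simp
    linarith
  set X : Ω → Fin m × Fin n × Fin n → ℝ := fun ω q => A q.1 ω q.2.1 q.2.2
  have hX : AEMeasurable X μ :=
    aemeasurable_pi_lambda _ fun q => (hA.hasLaw q.1 q.2.1 q.2.2).aemeasurable
  calc 1 - 2 * Real.exp (-(1 / (128 * Real.pi) * δ ^ 2 * m))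
      ≤ 1 - (stdGaussianPi (Fin m × Fin n × Fin n)).real B := by linarith
    _ = (stdGaussianPi (Fin m × Fin n × Fin n)).real Bᶜ := (probReal_compl_eq_one_sub hBm).symm
    _ = μ.real (X ⁻¹' Bᶜ) := by
        rw [← hA.map_eq, map_measureReal_apply_of_aemeasurable hX hBm.compl]
    -- Only monotonicity is used, so measurability of the RIP event is not needed.
    _ ≤ _ := measureReal_mono fun ω hω =>
        satisfiesRIP_of_forall_unitBisparse hm0 (X ω) (hgood (X ω) hω)
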